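/- Let $\Gamma$ be a finite simplicial graph (finite, no loops or multiple edges) whose edges $e$ are labelled by even integers $m_e\ge 2$, and let $$A_\Gamma=\langle V(\Gamma)\mid \langle v,w\rangle^{m_e}=\langle w,v\rangle^{m_e}\text{ for each edge } e=\{v,w\}\rangle$$ be its Artin group, where $\langle v,w\rangle^{m}=vwv\cdots$ is the alternating product of length $m$ starting with $v$. For $T\subseteq V(\Gamma)$ let $A_T$ be the subgroup of $A_\Gamma$ generated by $T$, and let $\Gamma_T$ be the full labelled subgraph spanned by $T$. Call $T$ a clique if any two distinct elements of $T$ are joined by an edge. Then there exist $n\ge 1$, a chain of group homomorphisms $$A_\Gamma\xrightarrow{q_1}A_1\xrightarrow{q_2}A_2\to\cdots\xrightarrow{q_n}A_n$$ and a finite collection of cliques $T_1,\dots,T_p$ of $\Gamma$ (repetitions allowed) such that $\ker q_i$ is a free group (of possibly infinite rank, the trivial group included) for every $i\in\{1,\dots,n\}$ and $$A_n\cong A_{T_1}\times A_{T_2}\times\cdots\times A_{T_p}\cong A_{\Gamma_{T_1}}\times A_{\Gamma_{T_2}}\times\cdots\times A_{\Gamma_{T_p}}.$$ (For $p=0$ the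 product is the trivial group.) -/

import Mathlib

universe u

/-- A simplicial graph on the vertex set `V` whose edges carry integer labels `≥ 2`. Only the
values of `label` on edges matter. -/
structure LabelledGraph (V : Type u) where
  graph : SimpleGraph V
  label : Sym2 V → ℕ
  two_le_label : ∀ e ∈ graph.edgeSet, 2 ≤ label e

/-- The alternating product `a b a ⋯` of length `n` starting with `a`. -/
def altProd {G : Type u} [Group G] (a b : G) : ℕ → G
  | 0 => 1
  | n + 1 => a * altProd b a n

namespace LabelledGraph

variable {V : Type u} (Γ : LabelledGraph V)

/-- All edge labels are even. -/
def IsEven : Prop := ∀ e ∈ Γ.graph.edgeSet, Even (Γ.label e)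

/-- The full labelled subgraph spanned by a set `T` of vertices. -/
def fullSubgraph (T : Set V) : LabelledGraph T where
  graph := Γ.graph.induce T
  label e := Γ.label (e.map Subtype.val)
  two_le_label := by
    intro e
    induction e with
    | _ v w => exact fun h => Γ.two_le_label s(v.1, w.1) h

/-- The relators `⟨v, w⟩ᵐ (⟨w, v⟩ᵐ)⁻¹`, one for each edge `{v, w}` (in both orders), where `m` is
the label of the edge. -/
def artinRels : Set (FreeGroup V) :=
  {r | ∃ v w : V, Γ.graph.Adj v w ∧
    r = altProd (FreeGroup.of v) (FreeGroup.of w) (Γ.label s(v, w)) *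
      (altProd (FreeGroup.of w) (FreeGroup.of v) (Γ.label s(v, w)))⁻¹}

/-- The Artin group of a labelled graph. -/
abbrev ArtinGroup : Type u := PresentedGroup Γ.artinRels

/-- The subgroup of the Artin group generated by a set `T` of vertices. -/
def artinSubgroup (T : Set V) : Subgroup Γ.ArtinGroup :=
  Subgroup.closure (PresentedGroup.of '' T)

end LabelledGraph

open Function

/-! If `v` and `w` in `S` are not joined, every edge in `S` avoids one of them, so the Artin group
of `S` is the amalgam of those of `S \ {w}` and `S \ {v}` over that of `S \ {v, w}`. Evenness makes
killing a vertex a homomorphism, so the factors are commuting retracts, and the map to their product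
has a kernel meeting all conjugates of the factors trivially. Such a kernel acts freely on the
Bass–Serre tree, hence is free; `isFreeGroup_ker_inf_ker` replaces the tree by an explicit action
and Nielsen–Schreier. Splitting both factors again, one coordinate at a time, ends in cliques
(`exists_freeKernelChain`). -/

/-- A group which embeds into a free group is free. -/
theorem IsFreeGroup.of_injective {G H : Type*} [Group G] [Group H] [IsFreeGroup H] (f : G →* H)
    (hf : Injective f) : IsFreeGroup G :=
  -- Nielsen–Schreier, by instance: the range is a subgroup of a free group.
  IsFreeGroup.ofMulEquiv (MonoidHom.ofInjective hf).symm

theorem MonoidHom.isFreeGroup_ker_of_injective {G : Type u} {H : Type*} [Group G] [Group H]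
    (f : G →* H) (hf : Injective f) : IsFreeGroup f.ker :=
  IsFreeGroup.of_injective (H := FreeGroup PEmpty.{u + 1}) 1 fun x y _ =>
    Subtype.ext <| hf <| by rw [MonoidHom.mem_ker.1 x.2, MonoidHom.mem_ker.1 y.2]

section AmalgamKernel

/-! Let `G` be generated by the images of two commuting retractions `p` and `q` and have the
universal property of the amalgam of these images over their intersection. Then `ker p ⊓ ker q` is
free: `G` acts on `(G × G) × FreeGroup G`, and evaluating this action at the base point embeds
the kernel into the free group. -/

variable {G : Type u} [Group G] (p q : G →* G)

/-- The action of `G` on the first factor of `(G × G) × L` by translations through `(p, q)`. -/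
def translationHom (L : Type*) : G →* Equiv.Perm ((G × G) × L) where
  toFun g := ((Equiv.mulLeft (p g)).prodCongr (Equiv.mulLeft (q g))).prodCongr (Equiv.refl L)
  map_one' := by ext x <;> simp
  map_mul' g h := by ext x <;> simp [mul_assoc]

@[simp]
theorem translationHom_apply (L : Type*) (g : G) (s : G × G) (l : L) :
    translationHom p q L g (s, l) = ((p g * s.1, q g * s.2), l) := rfl

/-- A section equivariant under the image of `p`. -/
def amalgamSection (s : G × G) : G := p s.1 * (p (q s.1))⁻¹ * q s.2

/-- The element of `G` comparing the two equivariant sections. -/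
def amalgamDefect (s : G × G) : G := (amalgamSection p q s)⁻¹ * amalgamSection q p s.swap

/-- The shear of `(G × G) × FreeGroup G` by the generators given by `amalgamDefect`. -/
def amalgamShear : Equiv.Perm ((G × G) × FreeGroup G) :=
  Equiv.prodShear (Equiv.refl _) fun s => Equiv.mulLeft (FreeGroup.of (amalgamDefect p q s))

@[simp]
theorem amalgamShear_apply (s : G × G) (l : FreeGroup G) :
    amalgamShear p q (s, l) = (s, FreeGroup.of (amalgamDefect p q s) * l) := rfl

@[simp]
theorem amalgamShear_inv_apply (s : G × G) (l : FreeGroup G) :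
    (amalgamShear p q)⁻¹ (s, l) = (s, (FreeGroup.of (amalgamDefect p q s))⁻¹ * l) := by
  rw [Equiv.Perm.inv_eq_iff_eq]
  simp

variable {p q}

/-- Used for `(p, q)` and for `(q, p)`, this makes the defect invariant under the common image of
`p` and `q`, so the shear commutes with the translations by that image. -/
theorem amalgamSection_smul (hp : ∀ x, p (p x) = p x) (hq : ∀ x, q (q x) = q x)
    (hpq : ∀ x, p (q x) = q (p x)) (g : G) (s : G × G) :
    amalgamSection p q (p (p g) * s.1, q (p g) * s.2) = p g * amalgamSection p q s := by
  simp only [amalgamSection, map_mul, hp, hq, hpq]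
  group

/-- A map that intertwines two actions of a generating set intertwines the actions. -/
theorem intertwines_of_closure_eq_top {X Y : Type*} (Φ : G →* Equiv.Perm X)
    (Ψ : G →* Equiv.Perm Y) (F : X → Y) {S : Set G} (hS : Subgroup.closure S = ⊤)
    (h : ∀ g ∈ S, ∀ x, F (Φ g x) = Ψ g (F x)) (g : G) (x : X) : F (Φ g x) = Ψ g (F x) := by
  have hg : g ∈ Subgroup.closure S := hS ▸ Subgroup.mem_top g
  induction hg using Subgroup.closure_induction generalizing x with
  | mem g hg => exact h g hg x
  | one => simp
  | mul a b _ _ ha hb => simp [ha, hb]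
  | inv a _ ha =>
    rw [map_inv, map_inv, Equiv.Perm.eq_inv_iff_eq, ← ha, ← Equiv.Perm.mul_apply, mul_inv_cancel,
      Equiv.Perm.one_apply]

/-- The kernel of the map from an amalgam of two retracts to their product is free. -/
theorem isFreeGroup_ker_inf_ker (hp : ∀ x, p (p x) = p x) (hq : ∀ x, q (q x) = q x)
    (hpq : ∀ x, p (q x) = q (p x))
    (hgen : Subgroup.closure (Set.range p ∪ Set.range q) = ⊤)
    (hlift : ∀ (H : Type u) [Group H] (f g : G →* H), (∀ x, f (p (q x)) = g (p (q x))) →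
      ∃ h : G →* H, (∀ x, h (p x) = f (p x)) ∧ ∀ x, h (q x) = g (q x)) :
    IsFreeGroup (p.ker ⊓ q.ker : Subgroup G) := by
  -- The image of `p` acts by translations, that of `q` by translations conjugated by the shear;
  -- invariance of the defect makes them agree on the intersection.
  obtain ⟨Φ, hΦp, hΦq⟩ := hlift (Equiv.Perm ((G × G) × FreeGroup G)) (translationHom p q _)
    ((MulAut.conj (amalgamShear p q)).toMonoidHom.comp (translationHom p q _)) <| by
      intro x
      have h₁ (s : G × G) := amalgamSection_smul hp hq hpq (q x) s
      have h₂ (s : G × G) := amalgamSection_smul hq hp (fun x => (hpq x).symm) (p x) s.swap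
      ext1 ⟨s, l⟩
      simp only [MonoidHom.comp_apply, MulEquiv.toMonoidHom_eq_coe, MonoidHom.coe_coe,
        MulAut.conj_apply, Equiv.Perm.mul_apply, amalgamShear_inv_apply, translationHom_apply,
        amalgamShear_apply, amalgamDefect, Prod.swap_prod_mk]
      simp only [← hpq, Prod.fst_swap, Prod.snd_swap] at h₁ h₂ ⊢
      rw [h₁, h₂]
      simp [mul_assoc]
  have hΦq' (g : G) (s : G × G) (l : FreeGroup G) : Φ (q g) (s, l) =
      ((p (q g) * s.1, q (q g) * s.2),
        FreeGroup.of (amalgamDefect p q (p (q g) * s.1, q (q g) * s.2)) *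
          ((FreeGroup.of (amalgamDefect p q s))⁻¹ * l)) := by
    rw [hΦq]
    simp only [MonoidHom.comp_apply, MulEquiv.toMonoidHom_eq_coe, MonoidHom.coe_coe,
      MulAut.conj_apply, Equiv.Perm.mul_apply, amalgamShear_inv_apply, translationHom_apply,
      amalgamShear_apply]
  -- Evaluating the free coordinate in `G` turns `Φ` into left multiplication: the shear inserts
  -- exactly the defect between the two sections.
  let τ (x : (G × G) × FreeGroup G) : G := amalgamSection p q x.1 * FreeGroup.lift id x.2
  have hτ : ∀ g x, τ (Φ g x) = g * τ x := by
    refine intertwines_of_closure_eq_top Φ (MulAction.toPermHom G G) τ hgen ?_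
    rintro _ (⟨g, rfl⟩ | ⟨g, rfl⟩) ⟨s, l⟩
    · rw [hΦp]
      simp [τ, amalgamSection_smul hp hq hpq, mul_assoc]
    · have h := amalgamSection_smul hq hp (fun x => (hpq x).symm) g s.swap
      simp only [Prod.fst_swap, Prod.snd_swap] at h
      rw [hΦq']
      simp [τ, amalgamDefect, h, mul_assoc]
  have hfst : ∀ g x, (Φ g x).1 = (p g * x.1.1, q g * x.1.2) := by
    refine intertwines_of_closure_eq_top Φ
      ((MulAction.toPermHom (G × G) (G × G)).comp (p.prod q)) Prod.fst hgen ?_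
    rintro _ (⟨g, rfl⟩ | ⟨g, rfl⟩) ⟨s, l⟩
    · rw [hΦp]; rfl
    · rw [hΦq']
      rfl
  have hmul (m : FreeGroup G) : ∀ g x, ((Φ g x).1, (Φ g x).2 * m) = Φ g (x.1, x.2 * m) := by
    refine intertwines_of_closure_eq_top Φ Φ (fun x => (x.1, x.2 * m)) hgen ?_
    rintro _ (⟨g, rfl⟩ | ⟨g, rfl⟩) ⟨s, l⟩
    · rw [hΦp]; rfl
    · rw [hΦq', hΦq']
      simp [mul_assoc]
  have hker (n : (p.ker ⊓ q.ker : Subgroup G)) (l : FreeGroup G) :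
      Φ n (1, l) = (1, (Φ n 1).2 * l) := by
    have h₁ := hfst n 1
    rw [MonoidHom.mem_ker.1 n.2.1, MonoidHom.mem_ker.1 n.2.2] at h₁
    have h₂ := hmul l n 1
    simp only [Prod.fst_one, Prod.snd_one, one_mul, h₁] at h₂
    rw [← h₂]
    rfl
  -- The free coordinate of the orbit of the base point is multiplicative since `Φ` commutes with
  -- right multiplication, and injective since `τ` recovers the group element.
  refine IsFreeGroup.of_injective (H := FreeGroup G)
    { toFun n := (Φ n 1).2
      map_one' := by simp
      map_mul' a b := ?_ } fun a b h => ?_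
  · have h := hker a (Φ b 1).2
    have hb := hker b 1
    rw [mul_one] at hb
    rw [← hb] at h
    rw [Subgroup.coe_mul, map_mul, Equiv.Perm.mul_apply]
    exact congrArg Prod.snd h
  · have key (n : (p.ker ⊓ q.ker : Subgroup G)) : FreeGroup.lift id (Φ n 1).2 = (n : G) := by
      have h := hτ n 1
      have hn : Φ n 1 = (1, (Φ n 1).2) := (hker n 1).trans (by rw [mul_one])
      rw [hn] at h
      simpa [τ, amalgamSection] using h
    exact Subtype.ext ((key a).symm.trans ((congrArg _ h).trans (key b)))

end AmalgamKernel

/-! ### Even Artin groups: retractions and amalgam splittings -/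

section EvenArtin

theorem map_altProd {G H : Type*} [Group G] [Group H] (f : G →* H) (a b : G) (n : ℕ) :
    f (altProd a b n) = altProd (f a) (f b) n := by
  induction n generalizing a b with
  | zero => simp [altProd]
  | succ n ih => simp [altProd, ih]

theorem altProd_one_right {G : Type*} [Group G] (a : G) (n : ℕ) :
    altProd a 1 (n + n) = a ^ n ∧ altProd 1 a (n + n) = a ^ n := by
  induction n with
  | zero => simp [altProd]
  | succ n ih =>
    rw [show n + 1 + (n + 1) = n + n + 1 + 1 by ring]
    simp [altProd, ih, pow_succ']

/-- This is where evenness enters: relations survive when one of their two vertices is killed. -/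
theorem altProd_one_comm {G : Type*} [Group G] (a : G) {n : ℕ} (hn : Even n) :
    altProd a 1 n = altProd 1 a n := by
  obtain ⟨k, rfl⟩ := hn
  rw [(altProd_one_right a k).1, (altProd_one_right a k).2]

namespace LabelledGraph

variable {V : Type u} (Γ : LabelledGraph V)

/-- The vertices of a graph as elements of its Artin group. -/
def artinOf (v : V) : Γ.ArtinGroup := PresentedGroup.of v

variable {Γ}

theorem altProd_artinOf {v w : V} (h : Γ.graph.Adj v w) :
    altProd (Γ.artinOf v) (Γ.artinOf w) (Γ.label s(v, w)) =
      altProd (Γ.artinOf w) (Γ.artinOf v) (Γ.label s(v, w)) := by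
  have := PresentedGroup.mk_eq_mk_of_mul_inv_mem (rels := Γ.artinRels) ⟨v, w, h, rfl⟩
  rw [map_altProd, map_altProd] at this
  exact this

/-- The homomorphism from an Artin group given by images of the vertices. -/
def artinLift {G : Type*} [Group G] (f : V → G)
    (hf : ∀ v w, Γ.graph.Adj v w →
      altProd (f v) (f w) (Γ.label s(v, w)) = altProd (f w) (f v) (Γ.label s(v, w))) :
    Γ.ArtinGroup →* G :=
  PresentedGroup.toGroup (f := f) <| by
    rintro _ ⟨v, w, h, rfl⟩
    rw [map_mul, map_inv, map_altProd, map_altProd, FreeGroup.lift_apply_of,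
      FreeGroup.lift_apply_of, hf v w h, mul_inv_cancel]

@[simp]
theorem artinLift_of {G : Type*} [Group G] (f : V → G) (hf) (v : V) :
    artinLift (Γ := Γ) f hf (Γ.artinOf v) = f v :=
  PresentedGroup.toGroup.of _

theorem artin_hom_ext {G : Type*} [Group G] {f g : Γ.ArtinGroup →* G}
    (h : ∀ v, f (Γ.artinOf v) = g (Γ.artinOf v)) : f = g :=
  PresentedGroup.ext h

theorem IsEven.fullSubgraph (hΓ : Γ.IsEven) (T : Set V) : (Γ.fullSubgraph T).IsEven := by
  intro e
  induction e with
  | _ v w => exact fun h => hΓ s(v.1, w.1) h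

variable (Γ) in
/-- The homomorphism from the Artin group of a full subgraph. -/
def artinIncl (T : Set V) : (Γ.fullSubgraph T).ArtinGroup →* Γ.ArtinGroup :=
  artinLift (fun v => Γ.artinOf v.1) fun v w h => altProd_artinOf (v := v.1) (w := w.1) h

@[simp]
theorem artinIncl_of (T : Set V) (v : T) :
    Γ.artinIncl T ((Γ.fullSubgraph T).artinOf v) = Γ.artinOf v.1 :=
  artinLift_of _ _ _

open Classical in
/-- The homomorphism onto the Artin group of a full subgraph that kills the other vertices. -/
noncomputable def artinProj (hΓ : Γ.IsEven) (T : Set V) :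
    Γ.ArtinGroup →* (Γ.fullSubgraph T).ArtinGroup :=
  artinLift (fun v => if h : v ∈ T then (Γ.fullSubgraph T).artinOf ⟨v, h⟩ else 1) <| by
    intro v w h
    have he := hΓ _ ((SimpleGraph.mem_edgeSet _).2 h)
    by_cases hv : v ∈ T <;> by_cases hw : w ∈ T <;> simp only [hv, hw, dite_true, dite_false]
    · exact altProd_artinOf (Γ := Γ.fullSubgraph T) (v := ⟨v, hv⟩) (w := ⟨w, hw⟩) h
    · exact altProd_one_comm _ he
    · exact (altProd_one_comm _ he).symm

theorem artinProj_of_mem (hΓ : Γ.IsEven) {T : Set V} {v : V} (h : v ∈ T) :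
    artinProj hΓ T (Γ.artinOf v) = (Γ.fullSubgraph T).artinOf ⟨v, h⟩ :=
  (artinLift_of _ _ _).trans (dif_pos h)

theorem artinProj_of_notMem (hΓ : Γ.IsEven) {T : Set V} {v : V} (h : v ∉ T) :
    artinProj hΓ T (Γ.artinOf v) = 1 :=
  (artinLift_of _ _ _).trans (dif_neg h)

theorem artinProj_artinIncl (hΓ : Γ.IsEven) (T : Set V) (x : (Γ.fullSubgraph T).ArtinGroup) :
    artinProj hΓ T (Γ.artinIncl T x) = x := by
  have : (artinProj hΓ T).comp (Γ.artinIncl T) = MonoidHom.id _ :=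
    artin_hom_ext fun v => by simp [artinProj_of_mem hΓ v.2]
  exact DFunLike.congr_fun this x

theorem range_artinIncl (T : Set V) : (Γ.artinIncl T).range = Γ.artinSubgroup T := by
  rw [MonoidHom.range_eq_map, ← PresentedGroup.closure_range_of, MonoidHom.map_closure,
    ← Set.range_comp, artinSubgroup, Set.image_eq_range]
  congr 2

/-- The subgroup generated by a set of vertices is the Artin group of the full subgraph. -/
noncomputable def artinSubgroupEquiv (hΓ : Γ.IsEven) (T : Set V) :
    (Γ.fullSubgraph T).ArtinGroup ≃* Γ.artinSubgroup T :=
  (MonoidHom.ofInjective (LeftInverse.injective (artinProj_artinIncl hΓ T))).trans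
    (MulEquiv.subgroupCongr (range_artinIncl T))

/-- The retraction of an even Artin group onto the subgroup generated by a set of vertices. -/
noncomputable def artinRetract (hΓ : Γ.IsEven) (T : Set V) : Γ.ArtinGroup →* Γ.ArtinGroup :=
  (Γ.artinIncl T).comp (artinProj hΓ T)

theorem artinRetract_of_mem (hΓ : Γ.IsEven) {T : Set V} {v : V} (h : v ∈ T) :
    artinRetract hΓ T (Γ.artinOf v) = Γ.artinOf v := by
  simp [artinRetract, artinProj_of_mem hΓ h]

theorem artinRetract_of_notMem (hΓ : Γ.IsEven) {T : Set V} {v : V} (h : v ∉ T) :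
    artinRetract hΓ T (Γ.artinOf v) = 1 := by
  simp [artinRetract, artinProj_of_notMem hΓ h]

theorem artinRetract_comp (hΓ : Γ.IsEven) (S T : Set V) :
    (artinRetract hΓ S).comp (artinRetract hΓ T) = artinRetract hΓ (S ∩ T) := by
  refine artin_hom_ext fun v => ?_
  rw [MonoidHom.comp_apply]
  by_cases hT : v ∈ T
  · rw [artinRetract_of_mem hΓ hT]
    by_cases hS : v ∈ S
    · rw [artinRetract_of_mem hΓ hS, artinRetract_of_mem hΓ (T := S ∩ T) ⟨hS, hT⟩]
    · rw [artinRetract_of_notMem hΓ hS, artinRetract_of_notMem hΓ (T := S ∩ T) fun h => hS h.1]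
  · rw [artinRetract_of_notMem hΓ hT, artinRetract_of_notMem hΓ (T := S ∩ T) fun h => hT h.2,
      map_one]

theorem artinRetract_artinRetract (hΓ : Γ.IsEven) (S T : Set V) (x : Γ.ArtinGroup) :
    artinRetract hΓ S (artinRetract hΓ T x) = artinRetract hΓ (S ∩ T) x :=
  DFunLike.congr_fun (artinRetract_comp hΓ S T) x

theorem le_ker_comp {G H K : Type*} [Group G] [Group H] [Group K] (g : H →* K) (f : G →* H) :
    f.ker ≤ (g.comp f).ker := fun x hx => by
  rw [MonoidHom.mem_ker, MonoidHom.comp_apply, MonoidHom.mem_ker.1 hx, map_one]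

/-- Killing either of two vertices that are not joined by an edge gives two homomorphisms whose
kernels meet in a free group. -/
theorem isFreeGroup_ker_artinRetract_inf (hΓ : Γ.IsEven) {v w : V} (hvw : v ≠ w)
    (hadj : ¬ Γ.graph.Adj v w) :
    IsFreeGroup ((artinRetract hΓ {w}ᶜ).ker ⊓ (artinRetract hΓ {v}ᶜ).ker :
      Subgroup Γ.ArtinGroup) := by
  classical
  refine isFreeGroup_ker_inf_ker (fun x => ?_) (fun x => ?_) (fun x => ?_) ?_ ?_
  · rw [artinRetract_artinRetract, Set.inter_self]
  · rw [artinRetract_artinRetract, Set.inter_self]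
  · rw [artinRetract_artinRetract, artinRetract_artinRetract, Set.inter_comm]
  · rw [eq_top_iff, ← PresentedGroup.closure_range_of]
    refine Subgroup.closure_mono ?_
    rintro _ ⟨x, rfl⟩
    by_cases hx : x = w
    · have hv : x ∈ ({v}ᶜ : Set V) := fun h => hvw (h.symm.trans hx)
      exact Or.inr ⟨Γ.artinOf x, artinRetract_of_mem hΓ hv⟩
    · have hw : x ∈ ({w}ᶜ : Set V) := hx
      exact Or.inl ⟨Γ.artinOf x, artinRetract_of_mem hΓ hw⟩
  · intro H _ f g hfg
    have hagree (x : V) (hv : x ≠ v) : (if x = w then g (Γ.artinOf x) else f (Γ.artinOf x)) =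
        g (Γ.artinOf x) := by
      split_ifs with hw
      · rfl
      · have := hfg (Γ.artinOf x)
        rwa [artinRetract_of_mem hΓ (T := {v}ᶜ) hv, artinRetract_of_mem hΓ (T := {w}ᶜ) hw] at this
    have hrel {K : Type u} [Group K] (k : Γ.ArtinGroup →* K) {x y : V} (h : Γ.graph.Adj x y) :
        altProd (k (Γ.artinOf x)) (k (Γ.artinOf y)) (Γ.label s(x, y)) =
          altProd (k (Γ.artinOf y)) (k (Γ.artinOf x)) (Γ.label s(x, y)) := by
      rw [← map_altProd, altProd_artinOf h, map_altProd]
    let h : Γ.ArtinGroup →* H :=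
      artinLift (fun x => if x = w then g (Γ.artinOf x) else f (Γ.artinOf x)) <| by
        intro x y hxy
        -- Since `v` and `w` are not joined, an edge touching `v` avoids `w`; each relation thus
        -- holds through `g` alone or `f` alone.
        by_cases hv : x ≠ v ∧ y ≠ v
        · simp only [hagree x hv.1, hagree y hv.2]
          exact hrel g hxy
        · have hx : x ≠ w := by
            rintro rfl
            exact hv ⟨hvw.symm, fun hy => hadj (hy ▸ hxy.symm)⟩
          have hy : y ≠ w := by
            rintro rfl
            exact hv ⟨fun hx => hadj (hx ▸ hxy), hvw.symm⟩
          simp only [if_neg hx, if_neg hy]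
          exact hrel f hxy
    refine ⟨h, fun x => ?_, fun x => ?_⟩
    · refine DFunLike.congr_fun (artin_hom_ext (f := h.comp _) (g := f.comp _) fun y => ?_) x
      by_cases hy : y = w
      · simp [artinRetract_of_notMem hΓ (T := {w}ᶜ) (v := y) (by simpa using hy)]
      · simp [artinRetract_of_mem hΓ (T := {w}ᶜ) (v := y) hy, h, hy]
    · refine DFunLike.congr_fun (artin_hom_ext (f := h.comp _) (g := g.comp _) fun y => ?_) x
      by_cases hy : y = v
      · simp [artinRetract_of_notMem hΓ (T := {v}ᶜ) (v := y) (by simpa using hy)]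
      · simp only [MonoidHom.comp_apply, artinRetract_of_mem hΓ (T := {v}ᶜ) (v := y) hy, h,
          artinLift_of, hagree y hy]

/-- The projection from the Artin group of one full subgraph to that of another. -/
noncomputable def artinRes (hΓ : Γ.IsEven) (S T : Set V) :
    (Γ.fullSubgraph S).ArtinGroup →* (Γ.fullSubgraph T).ArtinGroup :=
  (artinProj hΓ T).comp (Γ.artinIncl S)

theorem artinRes_comp_artinRes (hΓ : Γ.IsEven) (S : Set V) (w : S) :
    (artinRes hΓ (S \ {w.1}) S).comp (artinRes hΓ S (S \ {w.1})) =
      artinRetract (hΓ.fullSubgraph S) {w}ᶜ := by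
  refine artin_hom_ext fun v => ?_
  by_cases hv : v = w
  · rw [artinRetract_of_notMem _ (by simpa using hv)]
    simp [artinRes, hv, artinProj_of_notMem hΓ (T := S \ {w.1}) (v := w.1) (by simp)]
  · have hv' : v.1 ≠ w.1 := fun h => hv (Subtype.ext h)
    rw [artinRetract_of_mem _ hv]
    simp [artinRes, artinProj_of_mem hΓ (T := S \ {w.1}) (v := v.1) ⟨v.2, hv'⟩,
      artinProj_of_mem hΓ v.2]

theorem isFreeGroup_ker_artinRes_prod (hΓ : Γ.IsEven) {S : Set V} {v w : V} (hv : v ∈ S)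
    (hw : w ∈ S) (hvw : v ≠ w) (hadj : ¬ Γ.graph.Adj v w) :
    IsFreeGroup ((artinRes hΓ S (S \ {w})).prod (artinRes hΓ S (S \ {v}))).ker := by
  have := isFreeGroup_ker_artinRetract_inf (hΓ.fullSubgraph S) (v := ⟨v, hv⟩) (w := ⟨w, hw⟩)
    (fun h => hvw (congrArg Subtype.val h)) hadj
  rw [← artinRes_comp_artinRes hΓ, ← artinRes_comp_artinRes hΓ] at this
  rw [MonoidHom.ker_prod]
  -- Composing back into the group of `S` can only enlarge the kernels.
  exact IsFreeGroup.of_injective (Subgroup.inclusion <| inf_le_inf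
    (le_ker_comp (artinRes hΓ (S \ {w}) S) (artinRes hΓ S (S \ {w})))
    (le_ker_comp (artinRes hΓ (S \ {v}) S) (artinRes hΓ S (S \ {v}))))
    (Subgroup.inclusion_injective _)

end LabelledGraph

end EvenArtin

/-! ### Chains of homomorphisms with free kernels -/

section FreeChain

/-- There is a homomorphism with free kernel. -/
def FreeKernelStep (G H : GrpCat.{u}) : Prop := ∃ f : G →* H, IsFreeGroup f.ker

/-- The groups are linked by a finite chain of homomorphisms with free kernels. -/
def FreeKernelChain (G H : Type u) [Group G] [Group H] : Prop :=
  Relation.ReflTransGen FreeKernelStep (GrpCat.of G) (GrpCat.of H)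

namespace FreeKernelChain

variable {G H K L : Type u} [Group G] [Group H] [Group K] [Group L]

theorem of_hom (f : G →* H) (hf : IsFreeGroup f.ker) : FreeKernelChain G H :=
  .single ⟨f, hf⟩

theorem of_mulEquiv (e : G ≃* H) : FreeKernelChain G H :=
  of_hom e.toMonoidHom (MonoidHom.isFreeGroup_ker_of_injective _ e.injective)

theorem trans (h₁ : FreeKernelChain G H) (h₂ : FreeKernelChain H K) : FreeKernelChain G K :=
  Relation.ReflTransGen.trans h₁ h₂

theorem prod_left (h : FreeKernelChain G H) : FreeKernelChain (G × K) (H × K) := by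
  refine Relation.ReflTransGen.lift (r := FreeKernelStep) (p := FreeKernelStep)
    (fun A : GrpCat.{u} => GrpCat.of (A × K)) ?_ _ _ h
  rintro A B ⟨f, hf⟩
  refine ⟨f.prodMap (MonoidHom.id K), ?_⟩
  refine IsFreeGroup.of_injective (H := f.ker)
    (((MonoidHom.fst A K).comp (Subgroup.subtype _)).codRestrict f.ker fun x =>
      congrArg Prod.fst (MonoidHom.mem_ker.1 x.2)) fun x y h => ?_
  have hx := congrArg Prod.snd (MonoidHom.mem_ker.1 x.2)
  have hy := congrArg Prod.snd (MonoidHom.mem_ker.1 y.2)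
  exact Subtype.ext (Prod.ext (congrArg Subtype.val h) (hx.trans hy.symm))

/-- The factors move one after the other, since a product of two free kernels need not be free. -/
theorem prod (h₁ : FreeKernelChain G H) (h₂ : FreeKernelChain K L) :
    FreeKernelChain (G × K) (H × L) :=
  h₁.prod_left.trans <| (of_mulEquiv MulEquiv.prodComm).trans <|
    h₂.prod_left.trans (of_mulEquiv MulEquiv.prodComm)

/-- Indexing by all of `ℕ` is harmless: the sequence is padded with identities. The separate `q₀`
keeps even an empty chain nonempty. -/
theorem exists_seq {A B : GrpCat.{u}} (h : Relation.ReflTransGen FreeKernelStep A B) :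
    ∃ (n : ℕ) (C : ℕ → GrpCat.{u}) (q₀ : A →* C 0) (q : ∀ i, C i →* C (i + 1)),
      IsFreeGroup q₀.ker ∧ (∀ i, IsFreeGroup (q i).ker) ∧ Nonempty (C n ≃* B) := by
  induction h using Relation.ReflTransGen.head_induction_on with
  | refl => exact ⟨0, fun _ => B, .id _, fun _ => .id _,
      MonoidHom.isFreeGroup_ker_of_injective _ injective_id,
      fun _ => MonoidHom.isFreeGroup_ker_of_injective _ injective_id, ⟨.refl _⟩⟩
  | @head A A' hstep _ ih =>
    obtain ⟨f, hf⟩ := hstep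
    obtain ⟨n, C, q₀, q, h₀, hq, e⟩ := ih
    refine ⟨n + 1, fun i => i.casesOn A' C, f,
      fun i => match i with
        | 0 => q₀
        | i + 1 => q i, hf, ?_, e⟩
    rintro (_ | i)
    · exact h₀
    · exact hq i

end FreeKernelChain

theorem LabelledGraph.exists_freeKernelChain {V : Type u} [Finite V] {Γ : LabelledGraph V}
    (hΓ : Γ.IsEven) (S : Set V) :
    ∃ (ι : Type) (_ : Finite ι) (T : ι → Set V), (∀ j, Γ.graph.IsClique (T j)) ∧
      FreeKernelChain (Γ.fullSubgraph S).ArtinGroup (∀ j, (Γ.fullSubgraph (T j)).ArtinGroup) := by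
  induction S using WellFoundedLT.induction with
  | ind S ih =>
    by_cases hS : Γ.graph.IsClique S
    · exact ⟨Unit, inferInstance, fun _ => S, fun _ => hS,
        .of_mulEquiv (MulEquiv.piUnique fun _ : Unit => (Γ.fullSubgraph S).ArtinGroup).symm⟩
    · rw [SimpleGraph.isClique_iff, Set.Pairwise] at hS
      push Not at hS
      obtain ⟨v, hv, w, hw, hvw, hadj⟩ := hS
      obtain ⟨ι, _, T, hT, h₁⟩ := ih (S \ {w}) (Set.sdiff_singleton_ssubset.2 hw)
      obtain ⟨κ, _, U, hU, h₂⟩ := ih (S \ {v}) (Set.sdiff_singleton_ssubset.2 hv)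
      refine ⟨ι ⊕ κ, inferInstance, Sum.elim T U, Sum.rec hT hU, ?_⟩
      refine (FreeKernelChain.of_hom _
        (isFreeGroup_ker_artinRes_prod hΓ hv hw hvw hadj)).trans ((h₁.prod h₂).trans ?_)
      exact .of_mulEquiv (MulEquiv.symm
        { Equiv.sumPiEquivProdPi fun j => (Γ.fullSubgraph (Sum.elim T U j)).ArtinGroup with
          map_mul' := fun _ _ => rfl })

end FreeChain

/-- The chain consists of `q₀` and `n` further maps, so its length `n + 1` is at least 1. -/
theorem mainTheorem5 {V : Type u} [Finite V] (Γ : LabelledGraph V) (hΓ : Γ.IsEven) :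
    ∃ (n : ℕ) (A : Fin (n + 1) → Type u) (_ : ∀ i, Group (A i))
      (q₀ : Γ.ArtinGroup →* A 0) (q : ∀ i : Fin n, A i.castSucc →* A i.succ)
      (p : ℕ) (T : Fin p → Set V),
      IsFreeGroup q₀.ker ∧
      (∀ i, IsFreeGroup (q i).ker) ∧
      (∀ j, Γ.graph.IsClique (T j)) ∧
      Nonempty (A (Fin.last n) ≃* (∀ j, Γ.artinSubgroup (T j))) ∧
      Nonempty (A (Fin.last n) ≃* (∀ j, (Γ.fullSubgraph (T j)).ArtinGroup)) := by
  obtain ⟨ι, _, T, hT, hchain⟩ := LabelledGraph.exists_freeKernelChain hΓ Set.univ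
  have htop : Γ.artinSubgroup Set.univ = ⊤ := by
    rw [LabelledGraph.artinSubgroup, Set.image_univ, PresentedGroup.closure_range_of]
  have e₀ : Γ.ArtinGroup ≃* (Γ.fullSubgraph Set.univ).ArtinGroup :=
    (Subgroup.topEquiv.symm.trans (MulEquiv.subgroupCongr htop.symm)).trans
      (LabelledGraph.artinSubgroupEquiv hΓ Set.univ).symm
  obtain ⟨n, C, q₀, q, h₀, hq, ⟨e⟩⟩ :=
    FreeKernelChain.exists_seq ((FreeKernelChain.of_mulEquiv e₀).trans hchain)
  obtain ⟨p, ⟨ε⟩⟩ := Finite.exists_equiv_fin ι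
  have e' : C n ≃* ∀ j, (Γ.fullSubgraph (T (ε.symm j))).ArtinGroup := e.trans
    { Equiv.piCongrLeft' (fun j => (Γ.fullSubgraph (T j)).ArtinGroup) ε with
      map_mul' := fun _ _ => rfl }
  exact ⟨n, fun i => C i, fun i => inferInstance, q₀, fun i => q i, p, fun j => T (ε.symm j), h₀,
    fun i => hq i, fun j => hT _,
    ⟨e'.trans (MulEquiv.piCongrRight fun j => LabelledGraph.artinSubgroupEquiv hΓ _)⟩, ⟨e'⟩⟩
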